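/- A graph is \emph{outerplanar} if it can be drawn without crossings in a closed disc (vertices as distinct points, edges as simple arcs) with all its vertices on the boundary circle; equivalently, if it has a plane drawing with all vertices on the boundary of the outer face. It is \emph{maximal outerplanar} if it is outerplanar and adding any edge between two non-adjacent vertices destroys outerplanarity. Let $\mathcal{O}_n$ be the class of all maximal outerplanar graphs with $n$ vertices, and let $M_k$ be a matching of size $k$, that is, the graph consisting of $k$ pairwise disjoint edges. A subgraph of an edge-coloured graph is \emph{rainbow} if no two of its edges have the same colour. Let $ar(\mathcal{O}_n,M_k)$ be the maximum number of colours that occur in an edge-colouring of a graph $G\in\mathcal{O}_n$ in which $G$ contains no rainbow copy of $M_k$. Theorem. Let $k\ge 2$ and $n\ge 3k-3$, and suppose that $n\ge 2k$ (this excludes only $k=2$, $n=3$). Then the maximum $ar(\mathcal{O}_n,M_k)$ exists, and $$ar(\mathcal{O}_n,M_k)\le n+4k-9 .$$ That is, every edge-colouring, with at least $n+4k-8$ colours, of any maximal outerplanar graph of order $n$ contains a rainbow matching of size $k$. -/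

import Mathlib

/-- `IsArcBetween A a b`: the set `A` is a simple (injective) arc in the plane with ends `a`, `b`. -/
def IsArcBetween (A : Set ℂ) (a b : ℂ) : Prop :=
  ∃ γ : Path a b, Function.Injective γ ∧ Set.range γ = A

/-- A crossing-free drawing of the graph `G` in the closed unit disc with all vertices on the
boundary circle (equivalently, a plane drawing with all vertices on the outer face). Vertices are
distinct points, edges are simple arcs joining their ends, an arc passes through no further vertex,
and two different arcs meet only in common end vertices. -/
structure OuterplanarDrawing {V : Type*} (G : SimpleGraph V) where
  /-- the point that represents a vertex -/
  pos : V → ℂ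
  /-- the arc that represents an edge -/
  arc : G.edgeSet → Set ℂ
  pos_injective : Function.Injective pos
  pos_mem_circle : ∀ v, pos v ∈ Metric.sphere (0 : ℂ) 1
  arc_subset_disc : ∀ e, arc e ⊆ Metric.closedBall (0 : ℂ) 1
  isArcBetween : ∀ (u v : V) (h : G.Adj u v), IsArcBetween (arc ⟨s(u, v), h⟩) (pos u) (pos v)
  mem_of_pos_mem_arc : ∀ (w : V) (e : G.edgeSet), pos w ∈ arc e → w ∈ (e : Sym2 V)
  arc_inter_arc : ∀ e f : G.edgeSet, e ≠ f →
    arc e ∩ arc f ⊆ pos '' {w | w ∈ (e : Sym2 V) ∧ w ∈ (f : Sym2 V)}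

/-- A graph is outerplanar if it has a crossing-free drawing in a closed disc with all its vertices
on the boundary of the disc. -/
def IsOuterplanar {V : Type*} (G : SimpleGraph V) : Prop :=
  Nonempty (OuterplanarDrawing G)

/-- A graph is maximal outerplanar if it is outerplanar and no graph on the same vertex set with
more edges is outerplanar. -/
def IsMaximalOuterplanar {V : Type*} (G : SimpleGraph V) : Prop :=
  Maximal IsOuterplanar G

/-- The class of maximal outerplanar graphs of order `n`, on the vertex set `Fin n`. -/
def maximalOuterplanarGraphs (n : ℕ) : Set (SimpleGraph (Fin n)) :=
  {G | IsMaximalOuterplanar G}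

/-- The matching of size `k`: the graph that consists of `k` pairwise disjoint edges. -/
def matchingGraph (k : ℕ) : SimpleGraph (Fin k × Bool) where
  Adj p q := p.1 = q.1 ∧ p.2 ≠ q.2
  symm := ⟨fun _ _ h => ⟨h.1.symm, h.2.symm⟩⟩
  loopless := ⟨fun _ h => h.2 rfl⟩

/-- The edge-coloured graph `G` contains a rainbow copy of `H`: a subgraph isomorphic to `H` whose
edges have pairwise different colours. -/
def HasRainbowCopy {V W C : Type*} {G : SimpleGraph V} (c : G.edgeSet → C)
    (H : SimpleGraph W) : Prop :=
  ∃ f : SimpleGraph.Copy H G, Function.Injective fun e : H.edgeSet => c (f.toHom.mapEdgeSet e)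

/-- The numbers `m` such that some graph in the class `𝒢` has an edge-colouring with exactly `m`
colours that contains no rainbow copy of `H`. -/
def rainbowFreeColorCounts {V W : Type*} (𝒢 : Set (SimpleGraph V)) (H : SimpleGraph W) : Set ℕ :=
  {m | ∃ G ∈ 𝒢, ∃ c : G.edgeSet → Fin m, Function.Surjective c ∧ ¬ HasRainbowCopy c H}

/-- The anti-Ramsey number of `H` in the class `𝒢`: the maximum number of colours in an
edge-colouring of a graph in `𝒢` that contains no rainbow copy of `H`. -/
noncomputable def antiRamsey {V W : Type*} (𝒢 : Set (SimpleGraph V)) (H : SimpleGraph W) : ℕ :=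
  sSup (rainbowFreeColorCounts 𝒢 H)

/-! Choose one edge of each colour. A matching in the resulting subgraph `H` is rainbow, so the
theorem is an extremal bound: an outerplanar graph of order n ≥ 2k without a k-matching has at most
n + 4k - 9 edges (`SimpleGraph.NonCrossing.card_edgeFinset_le`). Topology enters once. Ordering the
vertices by argument on the circle leaves no two crossing edges, because curves in the disc with
interleaved ends meet (`exists_eq_of_interleaved`). All later counting uses only this combinatorial
property. Let a maximum matching have m < k edges, with m > 0, and let U be the n - 2m unmatched
vertices, an independent set. The 2m matched vertices span at most 4m - 3 edges. Without augmenting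
paths of length three, if both ends of a matching edge have neighbours in U, they have just one, the
same; such a pair sends 2 edges to U. Every other pair has at most one end with neighbours in U, and
`sum_card_adj_le` bounds the edges from t ≥ 1 such ends by |U| + 2t - 2. So at most max(2m, n - 2)
edges go to U, and n ≥ 2k ≥ 2m + 2 makes this n - 2. The total is at most n + 4m - 5 ≤ n + 4k - 9.
-/

/-! ### Curves in the disc with interleaved ends -/

/-- For `0 < φ < 2π` the argument of `1 - exp (φ * I)` is `(φ - π) / 2`. -/
theorem Complex.arg_one_sub_exp_mul_I {φ : ℝ} (h0 : 0 < φ) (h2 : φ < 2 * Real.pi) :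
    (1 - Complex.exp (φ * Complex.I)).arg = (φ - Real.pi) / 2 := by
  have hs : 0 < 2 * Real.sin (φ / 2) := by
    have := Real.sin_pos_of_pos_of_lt_pi (x := φ / 2) (by linarith) (by linarith)
    linarith
  have hφ : φ = 2 * (φ / 2) := by ring
  have h1 : (φ - Real.pi) / 2 = φ / 2 - Real.pi / 2 := by ring
  have key : (1 - Complex.exp (φ * Complex.I)) = ((2 * Real.sin (φ / 2) : ℝ) : ℂ) *
      (Complex.cos (((φ - Real.pi) / 2 : ℝ) : ℂ) +
        Complex.sin (((φ - Real.pi) / 2 : ℝ) : ℂ) * Complex.I) := by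
    have hc : Real.cos φ = 2 * Real.cos (φ / 2) ^ 2 - 1 := by rw [← Real.cos_two_mul, ← hφ]
    have hs : Real.sin φ = 2 * Real.sin (φ / 2) * Real.cos (φ / 2) := by
      rw [← Real.sin_two_mul, ← hφ]
    have h : ((Real.sin (φ / 2) : ℝ) : ℂ) ^ 2 + ((Real.cos (φ / 2) : ℝ) : ℂ) ^ 2 = 1 := by
      exact_mod_cast Real.sin_sq_add_cos_sq (φ / 2)
    rw [Complex.exp_mul_I, ← Complex.ofReal_cos, ← Complex.ofReal_sin, ← Complex.ofReal_cos,
      ← Complex.ofReal_sin, h1, Real.cos_sub_pi_div_two, Real.sin_sub_pi_div_two, hc, hs]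
    simp only [Complex.ofReal_mul, Complex.ofReal_sub, Complex.ofReal_pow, Complex.ofReal_neg,
      Complex.ofReal_one, Complex.ofReal_ofNat]
    linear_combination (-2) * h
  rw [key, Complex.arg_mul_cos_add_sin_mul_I hs]
  constructor <;> linarith [Real.pi_pos]

/-- A point of the closed unit disc other than `1` has a distance from `1` in the open right
half-plane. -/
theorem Complex.re_one_sub_pos {z : ℂ} (hz : ‖z‖ ≤ 1) (h1 : z ≠ 1) : 0 < (1 - z).re := by
  have hle : z.re ≤ ‖z‖ := Complex.re_le_norm z
  rcases lt_or_eq_of_le (hle.trans hz) with h | h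
  · simpa using h
  · exfalso
    apply h1
    have h2 := Complex.sq_norm z
    rw [Complex.normSq_apply] at h2
    have h3 : ‖z‖ ^ 2 ≤ 1 := by
      have := norm_nonneg z
      nlinarith
    apply Complex.ext
    · simpa using h
    · have : z.im * z.im ≤ 0 := by rw [h] at h2; linarith
      have : z.im = 0 := by nlinarith
      simpa using this

/-- A continuous logarithm of `σ * (p - f s)`, where `p` is on the unit circle and `f` is a curve in
the closed unit disc avoiding `p`, changes its imaginary part by half of the angle between the
ends of the curve. -/
theorem im_sub_im_of_exp_eq {p σ : ℂ} (hp : ‖p‖ = 1) {f L : ℝ → ℂ}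
    (hf : Continuous f) (hL : Continuous L) (hf1 : ∀ s, ‖f s‖ ≤ 1) (hfp : ∀ s, f s ≠ p)
    (hexp : ∀ s, Complex.exp (L s) = σ * (p - f s)) {φ₀ φ₁ : ℝ}
    (h0 : 0 < φ₀) (h0' : φ₀ < 2 * Real.pi) (h1 : 0 < φ₁) (h1' : φ₁ < 2 * Real.pi)
    (hf0 : f 0 = p * Complex.exp (φ₀ * Complex.I))
    (hf1' : f 1 = p * Complex.exp (φ₁ * Complex.I)) :
    (L 1).im - (L 0).im = (φ₁ - φ₀) / 2 := by
  have hp0 : p ≠ 0 := by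
    rintro rfl
    simp at hp
  have hre : ∀ s, 0 < (1 - f s / p).re := fun s => by
    apply Complex.re_one_sub_pos
    · rw [norm_div, hp, div_one]
      exact hf1 s
    · intro h
      exact hfp s ((div_eq_one_iff_eq hp0).1 h)
  have hne : ∀ s, 1 - f s / p ≠ 0 := fun s h => by
    have := hre s
    rw [h] at this
    simp at this
  -- Since `1 - f s / p` stays in the right half-plane, its principal logarithm is continuous. It
  -- differs from `L` by a continuous logarithm of the constant `σ * p`, which is constant.
  let g : ℝ → ℂ := fun s => L s - Complex.log (1 - f s / p)
  have hg : Continuous g := by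
    refine hL.sub (Continuous.clog (by fun_prop) fun s => ?_)
    exact Or.inl (hre s)
  have hge : ∀ s, Complex.exp (g s) = σ * p := fun s => by
    simp only [g]
    rw [Complex.exp_sub, Complex.exp_log (hne s), hexp]
    rw [div_eq_iff (hne s)]
    field_simp
  have hconst : g 1 = g 0 :=
    Complex.isCoveringMap_exp.const_of_comp hg
      (fun a a' => Subtype.ext ((hge a).trans (hge a').symm)) 1 0
  have him := congrArg Complex.im hconst
  simp only [g, Complex.sub_im, Complex.log_im] at him
  rw [hf0, hf1', mul_div_cancel_left₀ _ hp0, mul_div_cancel_left₀ _ hp0,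
    Complex.arg_one_sub_exp_mul_I h0 h0', Complex.arg_one_sub_exp_mul_I h1 h1'] at him
  linarith

/-- Two curves in the closed unit disc whose ends interleave on the unit circle meet. -/
theorem exists_eq_of_interleaved {γ δ : ℝ → ℂ} (hγ : Continuous γ) (hδ : Continuous δ)
    (hγ1 : ∀ s, ‖γ s‖ ≤ 1) (hδ1 : ∀ s, ‖δ s‖ ≤ 1) {α β ξ η : ℝ}
    (h₁ : α < β) (h₂ : β < ξ) (h₃ : ξ < η) (h₄ : η < α + 2 * Real.pi)
    (hγ0 : γ 0 = Complex.exp (α * Complex.I)) (hγe : γ 1 = Complex.exp (ξ * Complex.I))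
    (hδ0 : δ 0 = Complex.exp (β * Complex.I)) (hδe : δ 1 = Complex.exp (η * Complex.I)) :
    ∃ s t, γ s = δ t := by
  by_contra! hne
  obtain ⟨L, hL, hLe⟩ := Complex.exists_continuousOn_eqOn_exp_comp
    (X := ℝ × ℝ) (U := Set.univ) (g := fun x => γ x.1 - δ x.2)
    (Homeomorph.Set.univ (ℝ × ℝ)).toHomotopyEquiv.simplyConnectedSpace
    isOpen_univ (by fun_prop)
    (by
      rintro ⟨x, -, hx⟩
      exact hne _ _ (sub_eq_zero.1 hx))
  rw [continuousOn_univ] at hL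
  have hLe' : ∀ s t, Complex.exp (L (s, t)) = γ s - δ t := fun s t => hLe (Set.mem_univ (s, t))
  have hc : ∀ θ : ℝ, ‖Complex.exp (θ * Complex.I)‖ = 1 := Complex.norm_exp_ofReal_mul_I
  have hadd : ∀ θ φ : ℝ, Complex.exp (θ * Complex.I) =
      Complex.exp (φ * Complex.I) * Complex.exp ((θ - φ : ℝ) * Complex.I) := fun θ φ => by
    rw [← Complex.exp_add]
    congr 1
    push_cast
    ring
  have hadd' : ∀ θ φ : ℝ, Complex.exp (θ * Complex.I) =
      Complex.exp (φ * Complex.I) * Complex.exp ((θ - φ + 2 * Real.pi : ℝ) * Complex.I) :=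
    fun θ φ => by
      rw [← Complex.exp_add, ← Complex.exp_periodic]
      congr 1
      push_cast
      ring
  -- Follow `Im L` along the sides of the unit square, where one of the two points is fixed on the
  -- circle. The two paths from `(0, 0)` to `(1, 1)` give changes that differ by 2π, which is
  -- impossible for a single-valued `L`. The shifts by 2π bring the angles into `(0, 2π)`.
  have e1 := im_sub_im_of_exp_eq (p := δ 0) (σ := -1) (f := γ) (L := fun s => L (s, 0))
    (by rw [hδ0, hc]) hγ (by fun_prop) hγ1 (fun s => hne s 0)
    (fun s => by rw [hLe']; ring) (φ₀ := α - β + 2 * Real.pi) (φ₁ := ξ - β)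
    (by linarith) (by linarith) (by linarith) (by linarith)
    (by rw [hγ0, hδ0]; exact hadd' _ _) (by rw [hγe, hδ0]; exact hadd _ _)
  have e2 := im_sub_im_of_exp_eq (p := γ 1) (σ := 1) (f := δ) (L := fun t => L (1, t))
    (by rw [hγe, hc]) hδ (by fun_prop) hδ1 (fun s => (hne 1 s).symm)
    (fun s => by rw [hLe']; ring) (φ₀ := β - ξ + 2 * Real.pi) (φ₁ := η - ξ)
    (by linarith) (by linarith) (by linarith) (by linarith)
    (by rw [hγe, hδ0]; exact hadd' _ _) (by rw [hγe, hδe]; exact hadd _ _)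
  have e3 := im_sub_im_of_exp_eq (p := δ 1) (σ := -1) (f := γ) (L := fun s => L (s, 1))
    (by rw [hδe, hc]) hγ (by fun_prop) hγ1 (fun s => hne s 1)
    (fun s => by rw [hLe']; ring) (φ₀ := α - η + 2 * Real.pi) (φ₁ := ξ - η + 2 * Real.pi)
    (by linarith) (by linarith) (by linarith) (by linarith)
    (by rw [hγ0, hδe]; exact hadd' _ _) (by rw [hγe, hδe]; exact hadd' _ _)
  have e4 := im_sub_im_of_exp_eq (p := γ 0) (σ := 1) (f := δ) (L := fun t => L (0, t))
    (by rw [hγ0, hc]) hδ (by fun_prop) hδ1 (fun s => (hne 0 s).symm)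
    (fun s => by rw [hLe']; ring) (φ₀ := β - α) (φ₁ := η - α)
    (by linarith) (by linarith) (by linarith) (by linarith)
    (by rw [hγ0, hδ0]; exact hadd _ _) (by rw [hγ0, hδe]; exact hadd _ _)
  linarith [Real.pi_pos]

/-! ### Non-crossing vertex orders -/

/-- No two edges `ac` and `bd` with `a < b < c < d` are both present. -/
def SimpleGraph.NonCrossing {V : Type*} [LinearOrder V] (G : SimpleGraph V) : Prop :=
  ∀ ⦃a b c d : V⦄, a < b → b < c → c < d → G.Adj a c → ¬ G.Adj b d

theorem SimpleGraph.NonCrossing.mono {V : Type*} [LinearOrder V] {G H : SimpleGraph V}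
    (hG : G.NonCrossing) (h : H ≤ G) : H.NonCrossing :=
  fun _ _ _ _ hab hbc hcd hac hbd => hG hab hbc hcd (h hac) (h hbd)

/-- The vertices of an outerplanar graph can be ordered so that no two edges cross. -/
theorem IsOuterplanar.exists_nonCrossing {V : Type*} {G : SimpleGraph V} (hG : IsOuterplanar G) :
    ∃ _ : LinearOrder V, G.NonCrossing := by
  obtain ⟨D⟩ := hG
  have hnorm : ∀ v, ‖D.pos v‖ = 1 := fun v => by simpa using D.pos_mem_circle v
  have hpos : ∀ v, D.pos v = Complex.exp ((D.pos v).arg * Complex.I) := fun v => by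
    conv_lhs => rw [← Complex.norm_mul_exp_arg_mul_I (D.pos v), hnorm v]
    simp
  have hinj : Function.Injective fun v => (D.pos v).arg := fun v w h => by
    apply D.pos_injective
    rw [hpos v, hpos w]
    simp only at h
    rw [h]
  refine ⟨LinearOrder.lift' _ hinj, fun a b c d hab hbc hcd hac hbd => ?_⟩
  have hab' : (D.pos a).arg < (D.pos b).arg := hab
  have hbc' : (D.pos b).arg < (D.pos c).arg := hbc
  have hcd' : (D.pos c).arg < (D.pos d).arg := hcd
  obtain ⟨γ, -, hγ⟩ := D.isArcBetween a c hac
  obtain ⟨δ, -, hδ⟩ := D.isArcBetween b d hbd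
  have hne : ∀ {x y : V}, (D.pos x).arg < (D.pos y).arg → x ≠ y := by
    rintro x y h rfl
    exact lt_irrefl _ h
  have hmemγ : ∀ s, γ.extend s ∈ D.arc ⟨s(a, c), hac⟩ := fun s => by
    rw [← hγ, ← γ.extend_range]
    exact ⟨s, rfl⟩
  have hmemδ : ∀ s, δ.extend s ∈ D.arc ⟨s(b, d), hbd⟩ := fun s => by
    rw [← hδ, ← δ.extend_range]
    exact ⟨s, rfl⟩
  obtain ⟨s, t, hst⟩ := exists_eq_of_interleaved γ.continuous_extend δ.continuous_extend
    (fun s => by simpa using D.arc_subset_disc _ (hmemγ s))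
    (fun s => by simpa using D.arc_subset_disc _ (hmemδ s)) hab' hbc' hcd'
    (by linarith [Complex.arg_le_pi (D.pos d), Complex.neg_pi_lt_arg (D.pos a)])
    (by rw [γ.extend_zero]; exact hpos a) (by rw [γ.extend_one]; exact hpos c)
    (by rw [δ.extend_zero]; exact hpos b) (by rw [δ.extend_one]; exact hpos d)
  have hef : (⟨s(a, c), hac⟩ : G.edgeSet) ≠ ⟨s(b, d), hbd⟩ := by
    intro h
    have h' := congrArg Subtype.val h
    simp only [Sym2.eq_iff] at h'
    rcases h' with h' | h'
    · exact hne hab' h'.1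
    · exact hne (hab'.trans (hbc'.trans hcd')) h'.1
  obtain ⟨w, ⟨hw1, hw2⟩, -⟩ := D.arc_inter_arc _ _ hef ⟨hmemγ s, hst ▸ hmemδ t⟩
  simp only [Sym2.mem_iff] at hw1 hw2
  rcases hw1 with rfl | rfl <;> rcases hw2 with h | h
  · exact hne hab' h
  · exact hne (hab'.trans (hbc'.trans hcd')) h
  · exact hne hbc' h.symm
  · exact hne hcd' h

/-! ### Edge counts in non-crossing graphs -/

open Finset in
/-- A non-crossing graph has at most `2 * #X - 3` edges inside a set `X` of at least two
vertices. -/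
theorem SimpleGraph.NonCrossing.card_filter_lt_adj_le {V : Type*} [LinearOrder V]
    {G : SimpleGraph V} [DecidableRel G.Adj] (hG : G.NonCrossing) {X : Finset V} (hX : 2 ≤ #X) :
    #{p ∈ X ×ˢ X | p.1 < p.2 ∧ G.Adj p.1 p.2} + 3 ≤ 2 * #X := by
  classical
  set E := {p ∈ X ×ˢ X | p.1 < p.2 ∧ G.Adj p.1 p.2} with hE
  have memE : ∀ p, p ∈ E ↔ (p.1 ∈ X ∧ p.2 ∈ X) ∧ p.1 < p.2 ∧ G.Adj p.1 p.2 := fun p => by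
    rw [hE, mem_filter, mem_product]
  rcases E.eq_empty_or_nonempty with hE0 | hE0
  · rw [hE0, card_empty]
    omega
  -- `R`: edges to the rightmost neighbour of their left end; `L`: edges to the leftmost neighbour
  -- of their right end. An edge in neither would yield two crossing edges. The longest edge at the
  -- smallest left end lies in both, so there are at most 2(#X - 1) - 1 edges.
  let R := {p ∈ E | ∀ z ∈ X, G.Adj p.1 z → z ≤ p.2}
  let L := {p ∈ E | ∀ z ∈ X, G.Adj z p.2 → p.1 ≤ z}
  have hXne : X.Nonempty := card_pos.1 (by omega)
  have hR : #R ≤ #X - 1 := by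
    rw [← card_erase_of_mem (X.max'_mem hXne)]
    refine card_le_card_of_injOn Prod.fst (fun p hp => ?_) fun p hp q hq hpq => ?_
    · have hp' := (memE p).1 (mem_filter.1 (mem_coe.1 hp)).1
      exact mem_coe.2 (mem_erase.2 ⟨(hp'.2.1.trans_le (X.le_max' _ hp'.1.2)).ne, hp'.1.1⟩)
    · have hp1 := mem_filter.1 (mem_coe.1 hp)
      have hq1 := mem_filter.1 (mem_coe.1 hq)
      have hp' := (memE p).1 hp1.1
      have hq' := (memE q).1 hq1.1
      exact Prod.ext hpq (le_antisymm (hq1.2 _ hp'.1.2 (hpq ▸ hp'.2.2))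
        (hp1.2 _ hq'.1.2 (hpq ▸ hq'.2.2)))
  have hL : #L ≤ #X - 1 := by
    rw [← card_erase_of_mem (X.min'_mem hXne)]
    refine card_le_card_of_injOn Prod.snd (fun p hp => ?_) fun p hp q hq hpq => ?_
    · have hp' := (memE p).1 (mem_filter.1 (mem_coe.1 hp)).1
      exact mem_coe.2 (mem_erase.2 ⟨((X.min'_le _ hp'.1.1).trans_lt hp'.2.1).ne', hp'.1.2⟩)
    · have hp1 := mem_filter.1 (mem_coe.1 hp)
      have hq1 := mem_filter.1 (mem_coe.1 hq)
      have hp' := (memE p).1 hp1.1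
      have hq' := (memE q).1 hq1.1
      exact Prod.ext (le_antisymm (hp1.2 _ hq'.1.1 (hpq ▸ hq'.2.2))
        (hq1.2 _ hp'.1.1 (hpq ▸ hp'.2.2))) hpq
  have hcover : E ⊆ R ∪ L := fun p hp => by
    by_contra hcon
    rw [mem_union, not_or] at hcon
    obtain ⟨h1, h2⟩ := hcon
    have h1' : ¬ ∀ z ∈ X, G.Adj p.1 z → z ≤ p.2 := fun h => h1 (mem_filter.2 ⟨hp, h⟩)
    have h2' : ¬ ∀ z ∈ X, G.Adj z p.2 → p.1 ≤ z := fun h => h2 (mem_filter.2 ⟨hp, h⟩)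
    push Not at h1' h2'
    obtain ⟨z, -, hz, hz'⟩ := h1'
    obtain ⟨w, -, hw, hw'⟩ := h2'
    exact hG hw' ((memE p).1 hp).2.1 hz' hw hz
  have hinter : 1 ≤ #(R ∩ L) := by
    rw [Nat.one_le_iff_ne_zero, ← Nat.pos_iff_ne_zero, card_pos]
    obtain ⟨p, hp, hpmin⟩ := E.exists_min_image Prod.fst hE0
    obtain ⟨q, hq, hqmax⟩ := {q ∈ E | q.1 = p.1}.exists_max_image Prod.snd
      ⟨p, mem_filter.2 ⟨hp, rfl⟩⟩
    obtain ⟨hqE, hqp⟩ := mem_filter.1 hq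
    have hq' := (memE q).1 hqE
    refine ⟨q, mem_inter.2 ⟨mem_filter.2 ⟨hqE, fun z hz hqz => ?_⟩,
      mem_filter.2 ⟨hqE, fun z hz hzq => ?_⟩⟩⟩
    · rcases lt_or_ge q.1 z with h | h
      · exact hqmax (q.1, z) (mem_filter.2 ⟨(memE _).2 ⟨⟨hq'.1.1, hz⟩, h, hqz⟩, hqp⟩)
      · exact h.trans hq'.2.1.le
    · rcases lt_or_ge z q.2 with h | h
      · rw [hqp]
        exact hpmin (z, q.2) ((memE _).2 ⟨⟨hz, hq'.1.2⟩, h, hzq⟩)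
      · exact hq'.2.1.le.trans h
  have := card_le_card hcover
  have := card_union_add_card_inter R L
  omega

open Finset in
/-- If `a` has three neighbours in `U`, and every vertex of `U` has two neighbours in `A`, then some
edge at `a` jumps over a vertex of `A`. -/
theorem SimpleGraph.NonCrossing.exists_adj_between {V : Type*} [LinearOrder V]
    {G : SimpleGraph V} [DecidableRel G.Adj] (hG : G.NonCrossing) {A U : Finset V}
    (hAU : Disjoint A U) (hU : ∀ u ∈ U, 2 ≤ #{a ∈ A | G.Adj a u}) {a : V}
    (haU : 3 ≤ #{u ∈ U | G.Adj a u}) :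
    ∃ u, G.Adj a u ∧ ∃ b ∈ A, a < b ∧ b < u ∨ u < b ∧ b < a := by
  have hneU : ∀ b ∈ A, ∀ u ∈ U, b ≠ u := fun b hb u hu h => Finset.disjoint_left.1 hAU hb (h ▸ hu)
  have hother : ∀ u ∈ U, ∃ b ∈ A, G.Adj b u ∧ b ≠ a := fun u hu => by
    obtain ⟨b, hb, hba⟩ := exists_mem_ne (hU u hu) a
    exact ⟨b, (mem_filter.1 hb).1, (mem_filter.1 hb).2, hba⟩
  have hsplit : {u ∈ U | G.Adj a u} =
      {u ∈ {u ∈ U | G.Adj a u} | a < u} ∪ {u ∈ {u ∈ U | G.Adj a u} | u < a} := by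
    rw [← filter_or, eq_comm, filter_eq_self]
    intro u hu
    exact lt_or_gt_of_ne (mem_filter.1 hu).2.ne
  have hcard := card_union_le {u ∈ {u ∈ U | G.Adj a u} | a < u} {u ∈ {u ∈ U | G.Adj a u} | u < a}
  rw [← hsplit] at hcard
  have htwo : (1 < #{u ∈ {u ∈ U | G.Adj a u} | a < u}) ∨
      (1 < #{u ∈ {u ∈ U | G.Adj a u} | u < a}) := by omega
  rcases htwo with h | h
  -- Two neighbours lie on the same side of `a`. The nearer one, `u₁`, has a second neighbour `b` in
  -- `A`, which the edge `a u₂` confines to the interval between `a` and `u₂`.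
  · obtain ⟨u₁, u₂, h1, h2, h12⟩ : ∃ u₁ u₂, u₁ ∈ {u ∈ {u ∈ U | G.Adj a u} | a < u} ∧
        u₂ ∈ {u ∈ {u ∈ U | G.Adj a u} | a < u} ∧ u₁ < u₂ := by
      obtain ⟨x, hx, y, hy, hxy⟩ := one_lt_card.1 h
      rcases lt_or_gt_of_ne hxy with h | h
      exacts [⟨x, y, hx, hy, h⟩, ⟨y, x, hy, hx, h⟩]
    simp only [mem_filter] at h1 h2
    obtain ⟨b, hb, hbu, hba⟩ := hother u₁ h1.1.1
    refine ⟨u₂, h2.1.2, b, hb, Or.inl ⟨?_, ?_⟩⟩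
    · by_contra hlt
      exact hG (lt_of_le_of_ne (not_lt.1 hlt) hba) h1.2 h12 hbu h2.1.2
    · by_contra hlt
      exact hG h1.2 h12 (lt_of_le_of_ne (not_lt.1 hlt) (hneU b hb u₂ h2.1.1).symm) h2.1.2 hbu.symm
  · obtain ⟨u₁, u₂, h1, h2, h12⟩ : ∃ u₁ u₂, u₁ ∈ {u ∈ {u ∈ U | G.Adj a u} | u < a} ∧
        u₂ ∈ {u ∈ {u ∈ U | G.Adj a u} | u < a} ∧ u₂ < u₁ := by
      obtain ⟨x, hx, y, hy, hxy⟩ := one_lt_card.1 h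
      rcases lt_or_gt_of_ne hxy with h | h
      exacts [⟨y, x, hy, hx, h⟩, ⟨x, y, hx, hy, h⟩]
    simp only [mem_filter] at h1 h2
    obtain ⟨b, hb, hbu, hba⟩ := hother u₁ h1.1.1
    refine ⟨u₂, h2.1.2, b, hb, Or.inr ⟨?_, ?_⟩⟩
    · by_contra hlt
      exact hG (lt_of_le_of_ne (not_lt.1 hlt) (hneU b hb u₂ h2.1.1)) h12 h1.2 hbu h2.1.2.symm
    · by_contra hlt
      exact hG h12 h1.2 (lt_of_le_of_ne (not_lt.1 hlt) hba.symm) h2.1.2.symm hbu.symm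

open Finset in
/-- In a non-crossing graph, an edge that jumps over a vertex of `A` forces a vertex of `U` with at
most one neighbour in `A` or a vertex of `A` with at most two neighbours in `U`. -/
theorem SimpleGraph.NonCrossing.not_adj_of_between {V : Type*} [LinearOrder V]
    {G : SimpleGraph V} [DecidableRel G.Adj] (hG : G.NonCrossing) {A U : Finset V}
    (hAU : Disjoint A U) (hU : ∀ u ∈ U, 2 ≤ #{a ∈ A | G.Adj a u})
    (hA : ∀ a ∈ A, 3 ≤ #{u ∈ U | G.Adj a u}) {l r b : V} (hb : b ∈ A) (hlb : l < b) (hbr : b < r) :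
    ¬ G.Adj l r := by
  -- Descent: an edge at `b` that jumps over a vertex of `A` stays within `[l, r]`, and `b`, now an
  -- endpoint, is no longer strictly inside.
  induction h : #{x ∈ A | l < x ∧ x < r} using Nat.strong_induction_on generalizing l r b with
  | _ N ih =>
    intro hlr
    obtain ⟨u, hbu, b', hb', hbetween⟩ := hG.exists_adj_between hAU hU (hA b hb)
    have hlu : l ≤ u := by
      by_contra hlt
      exact hG (not_le.1 hlt) hlb hbr hbu.symm hlr
    have hur : u ≤ r := by
      by_contra hlt
      exact hG hlb hbr (not_le.1 hlt) hlr hbu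
    have hbmem : b ∈ {x ∈ A | l < x ∧ x < r} := mem_filter.2 ⟨hb, hlb, hbr⟩
    rcases hbetween with ⟨h1, h2⟩ | ⟨h1, h2⟩
    · refine ih _ ?_ hb' h1 h2 rfl hbu
      rw [← h]
      refine card_lt_card ((ssubset_iff_of_subset fun x hx => ?_).2 ⟨b, hbmem, by simp⟩)
      simp only [mem_filter] at hx ⊢
      exact ⟨hx.1, hlb.trans hx.2.1, hx.2.2.trans_le hur⟩
    · refine ih _ ?_ hb' h1 h2 rfl hbu.symm
      rw [← h]
      refine card_lt_card ((ssubset_iff_of_subset fun x hx => ?_).2 ⟨b, hbmem, by simp⟩)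
      simp only [mem_filter] at hx ⊢
      exact ⟨hx.1, hlu.trans_lt hx.2.1, hx.2.2.trans hbr⟩

open Finset in
/-- A non-crossing graph has at most `#U + 2 * #A - 2` edges between disjoint vertex sets `A ≠ ∅`
and `U`. -/
theorem SimpleGraph.NonCrossing.sum_card_adj_le {V : Type*} [LinearOrder V]
    {G : SimpleGraph V} [DecidableRel G.Adj] (hG : G.NonCrossing) {A U : Finset V}
    (hAU : Disjoint A U) (hA : A.Nonempty) :
    ∑ a ∈ A, #{u ∈ U | G.Adj a u} + 2 ≤ #U + 2 * #A := by
  induction h : #A + #U using Nat.strong_induction_on generalizing A U with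
  | _ N ih =>
    -- Delete a vertex of `U` with at most one neighbour in `A`, or a vertex of `A` with at most two
    -- in `U`; the bound drops by 1 or 2 accordingly. By the preceding descent one of them exists.
    -- Only a last vertex of `A` cannot be deleted; it has at most `#U` edges and at most two.
    by_cases hU : ∀ u ∈ U, 2 ≤ #{a ∈ A | G.Adj a u}
    · by_cases hA3 : ∀ a ∈ A, 3 ≤ #{u ∈ U | G.Adj a u}
      · exfalso
        obtain ⟨a, ha⟩ := hA
        obtain ⟨u, hau, b, hb, ⟨h1, h2⟩ | ⟨h1, h2⟩⟩ := hG.exists_adj_between hAU hU (hA3 a ha)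
        · exact hG.not_adj_of_between hAU hU hA3 hb h1 h2 hau
        · exact hG.not_adj_of_between hAU hU hA3 hb h1 h2 hau.symm
      · push Not at hA3
        obtain ⟨a, ha, ha3⟩ := hA3
        have hcard := card_erase_add_one ha
        rw [← add_sum_erase _ _ ha]
        rcases (A.erase a).eq_empty_or_nonempty with hempty | hne
        · rw [hempty, card_empty] at hcard
          rw [hempty, sum_empty]
          have : #{u ∈ U | G.Adj a u} ≤ #U := card_filter_le _ _
          omega
        · have := ih _ (by omega) (hAU.mono_left (erase_subset a A)) hne rfl
          omega
    · push Not at hU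
      obtain ⟨u, hu, hu2⟩ := hU
      have hcard := card_erase_add_one hu
      have := ih _ (by omega) (hAU.mono_right (erase_subset u U)) hA rfl
      have hswap : ∀ W : Finset V, ∑ a ∈ A, #{u ∈ W | G.Adj a u} = ∑ u ∈ W, #{a ∈ A | G.Adj a u} :=
        fun W => sum_card_bipartiteAbove_eq_sum_card_bipartiteBelow G.Adj
      rw [hswap] at this ⊢
      rw [← add_sum_erase _ _ hu]
      omega

open Finset in
/-- In a non-crossing graph, let `φ` list the pairs of a matching, and suppose that the two ends of
a pair never have distinct neighbours in the set `U` of remaining vertices. Then there are few edges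
between the matched vertices and `U`. -/
theorem SimpleGraph.NonCrossing.sum_card_adj_matched_le {V ι : Type*} [LinearOrder V] [Fintype ι]
    {G : SimpleGraph V} [DecidableRel G.Adj] (hG : G.NonCrossing) {φ : ι × Bool → V}
    (hφ : Function.Injective φ) {U : Finset V} (hφU : ∀ p, φ p ∉ U)
    (haug : ∀ i, ∀ u ∈ U, ∀ u' ∈ U, G.Adj (φ (i, true)) u → G.Adj (φ (i, false)) u' → u = u') :
    ∑ p, #{u ∈ U | G.Adj (φ p) u} ≤ 2 * Fintype.card ι ∨
      ∑ p, #{u ∈ U | G.Adj (φ p) u} + 2 ≤ #U + 2 * Fintype.card ι := by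
  classical
  let d : V → ℕ := fun v => #{u ∈ U | G.Adj v u}
  change ∑ p, d (φ p) ≤ _ ∨ ∑ p, d (φ p) + 2 ≤ _
  rw [Fintype.sum_prod_type]
  simp only [Fintype.sum_bool]
  let T : Finset ι := {i | d (φ (i, true)) ≠ 0 ∧ d (φ (i, false)) ≠ 0}
  have hT : ∑ i ∈ T, (d (φ (i, true)) + d (φ (i, false))) ≤ 2 * #T := by
    rw [mul_comm, ← smul_eq_mul]
    refine sum_le_card_nsmul _ _ _ fun i hi => ?_
    obtain ⟨h1, h2⟩ := (mem_filter.1 hi).2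
    obtain ⟨u, hu⟩ := card_ne_zero.1 h1
    obtain ⟨u', hu'⟩ := card_ne_zero.1 h2
    simp only [mem_filter] at hu hu'
    have h1' : d (φ (i, true)) ≤ 1 := by
      refine card_le_one.2 fun x hx y hy => ?_
      simp only [mem_filter] at hx hy
      exact (haug i x hx.1 u' hu'.1 hx.2 hu'.2).trans (haug i y hy.1 u' hu'.1 hy.2 hu'.2).symm
    have h2' : d (φ (i, false)) ≤ 1 := by
      refine card_le_one.2 fun x hx y hy => ?_
      simp only [mem_filter] at hx hy
      exact (haug i u hu.1 x hx.1 hu.2 hx.2).symm.trans (haug i u hu.1 y hy.1 hu.2 hy.2)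
    omega
  rw [← sum_add_sum_compl T]
  rcases Tᶜ.eq_empty_or_nonempty with hempty | hne
  · left
    rw [hempty, sum_empty]
    have := card_le_univ T
    omega
  · right
    -- The only end of the pair that can have neighbours in `U`; if neither has any, the choice does
    -- not matter.
    let a : ι → V := fun i => φ (i, decide (d (φ (i, true)) ≠ 0))
    have ha : Function.Injective a := fun i j hij => congrArg Prod.fst (hφ hij)
    have hsum : ∑ i ∈ Tᶜ, (d (φ (i, true)) + d (φ (i, false))) = ∑ v ∈ Tᶜ.image a, d v := by
      rw [sum_image ha.injOn]
      refine sum_congr rfl fun i hi => ?_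
      by_cases h : d (φ (i, true)) = 0
      · simp [a, h]
      · have h2 : d (φ (i, false)) = 0 := by
          by_contra hne
          exact (mem_compl.1 hi) (mem_filter.2 ⟨mem_univ i, h, hne⟩)
        simp [a, h, h2]
    have hcard : #(Tᶜ.image a) = #Tᶜ := card_image_of_injective _ ha
    have hbound := hG.sum_card_adj_le (A := Tᶜ.image a) (U := U)
      (Finset.disjoint_left.2 fun v hv => by
        obtain ⟨i, -, rfl⟩ := mem_image.1 hv
        exact hφU _) (hne.image a)
    change ∑ v ∈ Tᶜ.image a, d v + 2 ≤ _ at hbound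
    have := card_add_card_compl T
    rw [hsum]
    omega

/-! ### Matchings and the extremal bound -/

/-- The graph contains a matching with `m` edges. -/
def SimpleGraph.HasMatching {V : Type*} (G : SimpleGraph V) (m : ℕ) : Prop :=
  ∃ φ : Fin m × Bool → V, Function.Injective φ ∧ ∀ i, G.Adj (φ (i, true)) (φ (i, false))

/-- A matching can be enlarged by an edge between two unmatched vertices. -/
theorem SimpleGraph.HasMatching.succ_of_adj {V : Type*} {G : SimpleGraph V} {m : ℕ}
    {φ : Fin m × Bool → V} (hφ : Function.Injective φ)
    (hadj : ∀ i, G.Adj (φ (i, true)) (φ (i, false))) {u v : V} (hu : ∀ p, φ p ≠ u)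
    (hv : ∀ p, φ p ≠ v) (huv : G.Adj u v) : G.HasMatching (m + 1) := by
  let ψ : Option (Fin m) × Bool → V := fun p => p.1.elim (bif p.2 then u else v) fun i => φ (i, p.2)
  have hψ : Function.Injective ψ := by
    rintro ⟨_ | i, _ | _⟩ ⟨_ | j, _ | _⟩ h <;>
      simp only [ψ, Option.elim, cond_true, cond_false] at h
    all_goals first
      | rfl
      | exact absurd h huv.ne
      | exact absurd h.symm huv.ne
      | exact absurd h (hu _)
      | exact absurd h.symm (hu _)
      | exact absurd h (hv _)
      | exact absurd h.symm (hv _)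
      | (have h' := hφ h
         simp_all)
  refine ⟨fun p => ψ (finSuccEquiv m p.1, p.2), fun p q h => ?_, fun i => ?_⟩
  · have h' := Prod.ext_iff.1 (hψ h)
    exact Prod.ext ((finSuccEquiv m).injective h'.1) h'.2
  · change G.Adj (ψ (finSuccEquiv m i, true)) (ψ (finSuccEquiv m i, false))
    rcases finSuccEquiv m i with _ | j
    · exact huv
    · exact hadj j

/-- A matching can be enlarged along an augmenting path with three edges. -/
theorem SimpleGraph.HasMatching.succ_of_augmenting {V : Type*} {G : SimpleGraph V} {m : ℕ}
    {φ : Fin m × Bool → V} (hφ : Function.Injective φ)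
    (hadj : ∀ i, G.Adj (φ (i, true)) (φ (i, false))) {u v : V} (hu : ∀ p, φ p ≠ u)
    (hv : ∀ p, φ p ≠ v) (huv : u ≠ v) {i : Fin m} (h1 : G.Adj (φ (i, true)) u)
    (h2 : G.Adj (φ (i, false)) v) : G.HasMatching (m + 1) := by
  classical
  -- Rematching `φ (i, true)` with `u` frees `φ (i, false)`, which can then be joined to `v`.
  refine succ_of_adj (φ := Function.update φ (i, false) u) (u := φ (i, false)) (v := v)
    (fun p q h => ?_) (fun j => ?_) (fun p => ?_) (fun p => ?_) h2
  · simp only [Function.update_apply] at h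
    split_ifs at h with hp hq hq
    · rw [hp, hq]
    · exact absurd h.symm (hu _)
    · exact absurd h (hu _)
    · exact hφ h
  · rw [Function.update_of_ne (by simp)]
    by_cases hj : j = i
    · subst hj
      rw [Function.update_self]
      exact h1
    · rw [Function.update_of_ne (by simpa using hj)]
      exact hadj j
  · rw [Function.update_apply]
    split_ifs with hp
    · exact (hu _).symm
    · exact fun h => hp (hφ h)
  · rw [Function.update_apply]
    split_ifs with hp
    · exact huv
    · exact hv p

theorem SimpleGraph.HasMatching.mono {V : Type*} {G : SimpleGraph V} {m k : ℕ} (hmk : m ≤ k)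
    (h : G.HasMatching k) : G.HasMatching m := by
  obtain ⟨φ, hφ, hadj⟩ := h
  refine ⟨fun p => φ (Fin.castLE hmk p.1, p.2), fun p q h => ?_, fun i => hadj _⟩
  have h' := Prod.ext_iff.1 (hφ h)
  exact Prod.ext (Fin.castLE_injective hmk h'.1) h'.2

open Finset in
/-- A non-crossing graph of order at least `2 * k` without a matching of size `k ≥ 2` has at most
`n + 4 * k - 9` edges. -/
theorem SimpleGraph.NonCrossing.card_edgeFinset_le {V : Type*} [LinearOrder V] [Fintype V]
    {G : SimpleGraph V} [DecidableRel G.Adj] (hG : G.NonCrossing) {k : ℕ} (hk : 2 ≤ k)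
    (hV : 2 * k ≤ Fintype.card V) (hM : ¬ G.HasMatching k) :
    #G.edgeFinset + 9 ≤ Fintype.card V + 4 * k := by
  classical
  obtain ⟨m, hm, ⟨φ, hφ, hadj⟩, hm1⟩ : ∃ m < k, G.HasMatching m ∧ ¬ G.HasMatching (m + 1) := by
    by_contra! hcon
    have : ∀ m ≤ k, G.HasMatching m := fun m => by
      induction m with
      | zero => exact fun _ => ⟨fun p => p.1.elim0, fun p => p.1.elim0, fun i => i.elim0⟩
      | succ m ih => exact fun hm => hcon m hm (ih (by omega))
    exact hM (this k le_rfl)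
  let W : Finset V := univ.image φ
  have hW : #W = 2 * m := by
    rw [card_image_of_injective _ hφ, card_univ, Fintype.card_prod, Fintype.card_fin,
      Fintype.card_bool, mul_comm]
  have hWU := card_add_card_compl W
  have hφU : ∀ p, φ p ∉ Wᶜ := fun p => by simp [W]
  have hUφ : ∀ u ∈ Wᶜ, ∀ p, φ p ≠ u := fun u hu p h => hφU p (h ▸ hu)
  have hcross := hG.sum_card_adj_matched_le hφ hφU fun i u hu u' hu' h1 h2 => by
    by_contra hne
    exact hm1 (.succ_of_augmenting hφ hadj (hUφ u hu) (hUφ u' hu') hne h1 h2)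
  have hsum : ∑ p, #{u ∈ Wᶜ | G.Adj (φ p) u} = ∑ v ∈ W, #{u ∈ Wᶜ | G.Adj v u} :=
    (sum_image (f := fun v => #{u ∈ Wᶜ | G.Adj v u}) hφ.injOn).symm
  have hcover : G.edgeFinset ⊆
      {p ∈ W ×ˢ W | p.1 < p.2 ∧ G.Adj p.1 p.2}.image (fun p => s(p.1, p.2)) ∪
        (W.sigma fun v => {u ∈ Wᶜ | G.Adj v u}).image (fun p => s(p.1, p.2)) := by
    intro e he
    induction e using Sym2.inductionOn with
    | _ u v =>
    have huv : G.Adj u v := by simpa using he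
    rw [mem_union, mem_image, mem_image]
    by_cases hu : u ∈ W <;> by_cases hv : v ∈ W
    · left
      rcases lt_or_gt_of_ne huv.ne with h | h
      · exact ⟨(u, v), mem_filter.2 ⟨mem_product.2 ⟨hu, hv⟩, h, huv⟩, rfl⟩
      · exact ⟨(v, u), mem_filter.2 ⟨mem_product.2 ⟨hv, hu⟩, h, huv.symm⟩, Sym2.eq_swap⟩
    · exact Or.inr ⟨⟨u, v⟩, mem_sigma.2 ⟨hu, mem_filter.2 ⟨mem_compl.2 hv, huv⟩⟩, rfl⟩
    · exact Or.inr ⟨⟨v, u⟩, mem_sigma.2 ⟨hv, mem_filter.2 ⟨mem_compl.2 hu, huv.symm⟩⟩,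
        Sym2.eq_swap⟩
    · exact absurd (.succ_of_adj hφ hadj (hUφ u (mem_compl.2 hu)) (hUφ v (mem_compl.2 hv)) huv) hm1
  have hcard := (card_le_card hcover).trans (card_union_le _ _)
  have hc1 := hcard.trans (Nat.add_le_add card_image_le card_image_le)
  rw [card_sigma, ← hsum] at hc1
  rw [Fintype.card_fin] at hcross
  -- The bound 2 * #W - 3 inside `W` needs two vertices, so the empty matching is separate.
  rcases Nat.eq_zero_or_pos m with rfl | hmpos
  · have hW0 : W = ∅ := card_eq_zero.1 hW
    have : ∑ p, #{u ∈ Wᶜ | G.Adj (φ p) u} = 0 := by rw [hsum, hW0, sum_empty]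
    rw [this, hW0] at hc1
    simp only [empty_product, filter_empty, card_empty] at hc1
    omega
  · have := hG.card_filter_lt_adj_le (X := W) (by omega)
    omega

/-! ### Rainbow matchings -/

/-- A graph with a matching of size `k` whose edges have pairwise distinct colours has a rainbow
copy of the matching graph. -/
theorem SimpleGraph.HasMatching.hasRainbowCopy {V C : Type*} {G H : SimpleGraph V} (hHG : H ≤ G)
    {c : G.edgeSet → C}
    (hc : ∀ e f : G.edgeSet, e.1 ∈ H.edgeSet → f.1 ∈ H.edgeSet → c e = c f → e = f)
    {k : ℕ} (h : H.HasMatching k) : HasRainbowCopy c (matchingGraph k) := by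
  obtain ⟨φ, hφ, hadj⟩ := h
  let F : matchingGraph k →g H := ⟨φ, by
    rintro ⟨i, _ | _⟩ ⟨j, _ | _⟩ ⟨h1, h2⟩ <;> simp only at h1 h2 <;> subst h1
    · exact absurd rfl h2
    · exact (hadj i).symm
    · exact hadj i
    · exact absurd rfl h2⟩
  let F' : SimpleGraph.Copy (matchingGraph k) G := ((SimpleGraph.Hom.ofLE hHG).comp F).toCopy hφ
  refine ⟨F', fun e f hef => ?_⟩
  exact SimpleGraph.Hom.mapEdgeSet.injective _ hφ
    (hc _ _ (F.mapEdgeSet e).2 (F.mapEdgeSet f).2 hef)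

/-- An edge-colouring of an outerplanar graph of order `n ≥ 2 * k` with at least `n + 4 * k - 8`
colours contains a rainbow matching of size `k ≥ 2`. -/
theorem IsOuterplanar.hasRainbowCopy_matchingGraph {V C : Type*} [Fintype V] {G : SimpleGraph V}
    (hG : IsOuterplanar G) (c : G.edgeSet → C) {k : ℕ} (hk : 2 ≤ k) (hV : 2 * k ≤ Fintype.card V)
    (hc : Fintype.card V + 4 * k ≤ (Set.range c).ncard + 8) :
    HasRainbowCopy c (matchingGraph k) := by
  classical
  obtain ⟨_, hnc⟩ := hG.exists_nonCrossing
  let σ : Set.range c → Sym2 V := fun x => x.2.choose.1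
  have hσ : ∀ x (e : G.edgeSet), e.1 = σ x → c e = x := fun x e he => by
    rw [Subtype.ext he]
    exact x.2.choose_spec
  have hσG : Set.range σ ⊆ G.edgeSet := by
    rintro _ ⟨x, rfl⟩
    exact x.2.choose.2
  have hσi : Function.Injective σ := fun x y hxy =>
    Subtype.ext ((hσ x ⟨σ x, hσG ⟨x, rfl⟩⟩ rfl).symm.trans (hσ y ⟨σ x, hσG ⟨x, rfl⟩⟩ hxy))
  let H : SimpleGraph V := SimpleGraph.fromEdgeSet (Set.range σ)
  have hH : H.edgeSet = Set.range σ := by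
    rw [SimpleGraph.edgeSet_fromEdgeSet]
    refine sdiff_eq_left.2 (Set.disjoint_left.2 fun e he hd => ?_)
    exact G.not_isDiag_of_mem_edgeSet (hσG he) hd
  have hHG : H ≤ G := SimpleGraph.edgeSet_subset_edgeSet.1 (hH ▸ hσG)
  -- Stated for every instance, so that it rewrites whichever one the extremal bound produces.
  have hcard : ∀ i : Fintype H.edgeSet, (@SimpleGraph.edgeFinset V H i).card =
      (Set.range c).ncard := by
    intro
    rw [← Set.ncard_coe_finset, SimpleGraph.coe_edgeFinset, hH, ← Nat.card_coe_set_eq,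
      ← Nat.card_coe_set_eq, Nat.card_range_of_injective hσi]
  by_cases hM : H.HasMatching k
  · refine hM.hasRainbowCopy hHG fun e f he hf hef => ?_
    rw [hH] at he hf
    obtain ⟨x, hx⟩ := he
    obtain ⟨y, hy⟩ := hf
    have hxy : x = y := Subtype.ext (by rw [← hσ x e hx.symm, ← hσ y f hy.symm, hef])
    exact Subtype.ext (by rw [← hx, ← hy, hxy])
  · have := (hnc.mono hHG).card_edgeFinset_le hk hV hM
    rw [hcard] at this
    omega

/-! ### Existence of the maximum -/

/-- The graph without edges on `Fin n` is outerplanar. -/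
theorem isOuterplanar_bot (n : ℕ) : IsOuterplanar (⊥ : SimpleGraph (Fin n)) := by
  have hempty : IsEmpty (⊥ : SimpleGraph (Fin n)).edgeSet := by
    rw [SimpleGraph.edgeSet_bot]
    infer_instance
  -- The angles `v / n` lie in `[0, 1]`, within the range of `arg`, so `arg` recovers them and the
  -- points are distinct.
  refine ⟨⟨fun v => Circle.exp (v / n), fun e => isEmptyElim e, fun v w h => ?_,
    fun v => mem_sphere_zero_iff_norm.2 (Circle.norm_coe _),
    fun e => isEmptyElim e, fun u v h => h.elim, fun _ e => isEmptyElim e, fun e => isEmptyElim e⟩⟩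
  have hbound : ∀ v : Fin n, 0 ≤ (v : ℝ) / n ∧ (v : ℝ) / n ≤ 1 := fun v =>
    ⟨by positivity, div_le_one_of_le₀ (by exact_mod_cast v.2.le) (by positivity)⟩
  have harg : ∀ v : Fin n, (Circle.exp ((v : ℝ) / n) : ℂ).arg = (v : ℝ) / n := fun v =>
    Circle.arg_exp (by linarith [Real.pi_pos, (hbound v).1])
      (by linarith [Real.pi_gt_three, (hbound v).2])
  have h' := congrArg Complex.arg h
  simp only [harg] at h'
  have hn : (n : ℝ) ≠ 0 := by
    have := v.pos
    positivity
  exact Fin.ext (by exact_mod_cast (div_left_inj' hn).1 h')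

/-- A colouring with at most one colour has no rainbow matching of size at least two. -/
theorem not_hasRainbowCopy_matchingGraph {V C : Type*} [Subsingleton C] {G : SimpleGraph V}
    (c : G.edgeSet → C) {k : ℕ} (hk : 2 ≤ k) : ¬ HasRainbowCopy c (matchingGraph k) := by
  rintro ⟨f, hf⟩
  have hadj : ∀ i : Fin k, (matchingGraph k).Adj (i, true) (i, false) := fun i => ⟨rfl, by simp⟩
  have h := congrArg Subtype.val <| @hf ⟨s((⟨0, by omega⟩, true), (⟨0, by omega⟩, false)), hadj _⟩
    ⟨s((⟨1, by omega⟩, true), (⟨1, by omega⟩, false)), hadj _⟩ (Subsingleton.elim _ _)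
  simp at h

/-- Some maximal outerplanar graph of order `n` has a colouring without a rainbow matching. -/
theorem rainbowFreeColorCounts_nonempty (n : ℕ) {k : ℕ} (hk : 2 ≤ k) :
    (rainbowFreeColorCounts (maximalOuterplanarGraphs n) (matchingGraph k)).Nonempty := by
  obtain ⟨G, -, hG⟩ := (Set.toFinite {G : SimpleGraph (Fin n) | IsOuterplanar G}).exists_le_maximal
    (isOuterplanar_bot n)
  rcases isEmpty_or_nonempty G.edgeSet with h | h
  · exact ⟨0, G, hG, fun e => isEmptyElim e, fun i => i.elim0,
      not_hasRainbowCopy_matchingGraph _ hk⟩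
  · exact ⟨1, G, hG, fun _ => 0, fun i => ⟨h.some, Subsingleton.elim _ _⟩,
      not_hasRainbowCopy_matchingGraph _ hk⟩

theorem theorem2 (n k : ℕ) (hk : 2 ≤ k) (hn : 3 * k - 3 ≤ n) (hnk : 2 * k ≤ n) :
    (IsGreatest (rainbowFreeColorCounts (maximalOuterplanarGraphs n) (matchingGraph k))
        (antiRamsey (maximalOuterplanarGraphs n) (matchingGraph k)) ∧
      (antiRamsey (maximalOuterplanarGraphs n) (matchingGraph k) : ℤ) ≤ (n : ℤ) + 4 * k - 9) ∧
    ∀ (V : Type*) [Fintype V] (G : SimpleGraph V) (C : Type*) (c : G.edgeSet → C),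
      Fintype.card V = n → IsMaximalOuterplanar G →
      (n : ℤ) + 4 * k - 8 ≤ ((Set.range c).ncard : ℤ) →
      HasRainbowCopy c (matchingGraph k) := by
  -- The natural subtraction does not truncate, as n + 4k ≥ 6k ≥ 12.
  have hbound : ∀ m ∈ rainbowFreeColorCounts (maximalOuterplanarGraphs n) (matchingGraph k),
      m ≤ n + 4 * k - 9 := by
    rintro m ⟨G, hG, c, hc, hfree⟩
    by_contra hlt
    refine hfree (hG.prop.hasRainbowCopy_matchingGraph c hk (by simpa using hnk) ?_)
    rw [hc.range_eq, Set.ncard_univ, Nat.card_fin, Fintype.card_fin]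
    omega
  -- A nonempty bounded set of naturals attains its supremum, so `antiRamsey` is not a default value
  -- of `sSup`.
  have hmem := Nat.sSup_mem (rainbowFreeColorCounts_nonempty n hk) ⟨_, hbound⟩
  refine ⟨⟨⟨hmem, fun m hm => le_csSup ⟨_, hbound⟩ hm⟩, ?_⟩, ?_⟩
  · have : antiRamsey (maximalOuterplanarGraphs n) (matchingGraph k) ≤ n + 4 * k - 9 :=
      hbound _ hmem
    omega
  · intro V _ G C c hV hG hc
    exact hG.prop.hasRainbowCopy_matchingGraph c hk (by omega) (by omega)
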